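/- All normed spaces are real. For a measure space $(\Omega,\Sigma,\mu)$ let $L^\infty(\mu)$ be the space of (classes modulo $\mu$-a.e. equality of) measurable essentially bounded functions $f:\Omega\to\mathbb{R}$ with the essential supremum norm, and for a normed space $X$ let $S_X=\{x\in X:\|x\|=1\}$. A map $T:A\to B$ between subsets of normed spaces is an isometry if $\|T(x)-T(y)\|=\|x-y\|$ for all $x,y\in A$, and a phase-isometry if $$\{\|T(x)+T(y)\|,\ \|T(x)-T(y)\|\}=\{\|x+y\|,\ \|x-y\|\}\qquad (x,y\in A).$$ Two maps $S,T:A\to B$ are phase-equivalent if there is a function $\varepsilon:A\to\{-1,1\}$ (not necessarily continuous) such that $\varepsilon\cdot T=S$. Let $Y$ be a Banach space and let $(\Omega,\Sigma,\mu)$ be an arbitrary measure space. Suppose that $T:S_{L^\infty(\mu)}\to S_Y$ is a surjective phase-isometry. Then $T$ is phase-equivalent to an isometry $S:S_{L^\infty(\mu)}\to S_Y$ which extends to a linear isometry from $L^\infty(\mu)$ onto $Y$. -/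

import Mathlib

open MeasureTheory
open scoped ENNReal

/-- A map `T : A → B` between subsets of two real normed spaces is a *phase-isometry* if
`{‖T x + T y‖, ‖T x - T y‖} = {‖x + y‖, ‖x - y‖}` for all `x, y ∈ A`. -/
def IsPhaseIsometry {X Y : Type*} [NormedAddCommGroup X] [NormedSpace ℝ X]
    [NormedAddCommGroup Y] [NormedSpace ℝ Y] {A : Set X} {B : Set Y} (T : A → B) : Prop :=
  ∀ x y : A,
    ({‖(T x : Y) + (T y : Y)‖, ‖(T x : Y) - (T y : Y)‖} : Set ℝ) =
      {‖(x : X) + (y : X)‖, ‖(x : X) - (y : X)‖}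

/-- Two maps `S, T : A → B` between subsets of two real normed spaces are *phase-equivalent* if
there is a (not necessarily continuous) function `ε : A → {-1, 1}` with `ε · T = S`. -/
def PhaseEquivalent {X Y : Type*} [NormedAddCommGroup X] [NormedSpace ℝ X]
    [NormedAddCommGroup Y] [NormedSpace ℝ Y] {A : Set X} {B : Set Y} (S T : A → B) : Prop :=
  ∃ ε : A → ({-1, 1} : Set ℝ), ∀ x : A, (ε x : ℝ) • (T x : Y) = (S x : Y)

/-!
Write `X = L^∞(μ)` and represent its elements by their limits `U.value x` along the ultrafilters `U`
that contain all conull sets; these values determine `x`. The heart of the matter is that every such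
`U` has a counterpart in `Y`: a functional `f U` in the dual unit ball with
`|f U (T x)| = |U.value x|` for all `x` in the sphere. To find it, note that `T` preserves in both
directions the relation `max ‖x + w‖ ‖x - w‖ = 2`. If `x = 1` on `A`, every `w` related to the
indicator function `1_A` is related to `x`. On the side of `Y` this forces every maximal convex
subset `D` of the sphere containing `T 1_A` to contain `T x` or `-T x`
(`IsPhaseIsometry.exists_strongDual`), so that a functional equal to `1` on `D` has modulus one at
`T x`. A weak-star limit as `A` shrinks along `U` (`exists_strongDual_abs_eq_one`) and two norm
comparisons (`abs_apply_eq_abs_value`) give `f U`, which is normalized to be `1` at the image of the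
constant function `1`.

As every vector of `Y` is a multiple of some `T w`, the functionals `f U` separate the points of
`Y`. It remains to see that in `f U (T x) = ± U.value x` the sign does not depend on `U`
(`IsValueSystem.hasCoherentSign`). This is shown successively for `1_A`, for `1_A - 1_B` and for
general `x`, each time by comparison with a vector `z` already treated and such that `‖x - z‖ ≤ 1`:
if the signs disagreed at two ultrafilters where `z = ± 1` has the sign of `x`, both of
`‖T x ± T z‖` would exceed one (`IsValueSystem.false_of_test`). That `T (1_A - 1_B)` does not take
the sign pattern of `1_A + 1_B` is a consequence of injectivity up to sign.

Choosing the signs accordingly yields vectors `Φ x` with `f U (Φ x) = U.value x` for all `U`, first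
on the sphere and then by homogeneity on all of `X`; `Φ` is linear because the `f U` separate
points.
-/

open Filter Topology

/-! ### Phase-isometries between unit spheres -/

section Sphere

theorem norm_coe_sphere {E : Type*} [NormedAddCommGroup E] (x : Metric.sphere (0 : E) 1) :
    ‖(x : E)‖ = 1 := by
  simp

variable {X Y : Type*} [NormedAddCommGroup X] [NormedSpace ℝ X]
  [NormedAddCommGroup Y] [NormedSpace ℝ Y]

section Map

variable {T : Metric.sphere (0 : X) 1 → Metric.sphere (0 : Y) 1}

theorem IsPhaseIsometry.norm_eq_or (hT : IsPhaseIsometry T) (x y : Metric.sphere (0 : X) 1) :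
    (‖(T x : Y) + T y‖ = ‖(x : X) + y‖ ∧ ‖(T x : Y) - T y‖ = ‖(x : X) - y‖) ∨
      (‖(T x : Y) + T y‖ = ‖(x : X) - y‖ ∧ ‖(T x : Y) - T y‖ = ‖(x : X) + y‖) :=
  Set.pair_eq_pair_iff.1 (hT x y)

theorem IsPhaseIsometry.max_norm_eq (hT : IsPhaseIsometry T) (x y : Metric.sphere (0 : X) 1) :
    max ‖(T x : Y) + T y‖ ‖(T x : Y) - T y‖ = max ‖(x : X) + y‖ ‖(x : X) - y‖ := by
  rcases hT.norm_eq_or x y with ⟨h₁, h₂⟩ | ⟨h₁, h₂⟩ <;> rw [h₁, h₂]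
  exact max_comm _ _

theorem IsPhaseIsometry.eq_or_eq_neg (hT : IsPhaseIsometry T) {x y : Metric.sphere (0 : X) 1}
    (h : (T x : Y) = T y ∨ (T x : Y) = -T y) : x = y ∨ x = -y := by
  have h0 : ‖(T x : Y) + T y‖ = 0 ∨ ‖(T x : Y) - T y‖ = 0 := by
    rcases h with h | h <;> simp [h]
  have h1 : ‖(x : X) + y‖ = 0 ∨ ‖(x : X) - y‖ = 0 := by
    rcases hT.norm_eq_or x y with ⟨h₁, h₂⟩ | ⟨h₁, h₂⟩ <;> rw [h₁, h₂] at h0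
    · exact h0
    · exact h0.symm
  rcases h1 with h1 | h1
  · right
    ext
    simpa using eq_neg_of_add_eq_zero_left (norm_eq_zero.1 h1)
  · left
    ext
    exact sub_eq_zero.1 (norm_eq_zero.1 h1)

theorem IsPhaseIsometry.apply_neg (hT : IsPhaseIsometry T) (hsurj : Function.Surjective T)
    (x : Metric.sphere (0 : X) 1) : (T (-x) : Y) = -T x := by
  obtain ⟨y, hy⟩ := hsurj (-T x)
  have hy' : (T y : Y) = -T x := by rw [hy]; rfl
  rcases hT.eq_or_eq_neg (Or.inr hy') with rfl | rfl
  · have h0 : (T y : Y) = 0 := by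
      have h2 : (2 : ℝ) • (T y : Y) = 0 := by
        rw [two_smul]
        nth_rewrite 1 [hy']
        exact neg_add_cancel _
      exact (smul_eq_zero.1 h2).resolve_left two_ne_zero
    have h1 := norm_coe_sphere (T y)
    rw [h0, norm_zero] at h1
    norm_num at h1
  · exact hy'

end Map

theorem exists_eq_norm_smul_of_surjective {ι : Type*} {T : ι → Metric.sphere (0 : Y) 1}
    (hsurj : Function.Surjective T) {y : Y} (hy : y ≠ 0) :
    ∃ w, y = ‖y‖ • (T w : Y) := by
  have hn : ‖y‖ ≠ 0 := norm_ne_zero_iff.2 hy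
  obtain ⟨w, hw⟩ := hsurj ⟨‖y‖⁻¹ • y, by simp [norm_smul, hn]⟩
  exact ⟨w, by rw [hw, smul_smul, mul_inv_cancel₀ hn, one_smul]⟩

/-- A convex subset of the unit sphere lies in a face cut out by a functional of norm at
most one. -/
theorem exists_strongDual_eq_one_of_convex {D : Set Y} (hD : Convex ℝ D)
    (hDs : D ⊆ Metric.sphere 0 1) :
    ∃ f : StrongDual ℝ Y, ‖f‖ ≤ 1 ∧ ∀ d ∈ D, f d = 1 := by
  obtain ⟨f, u, hfu, huf⟩ := geometric_hahn_banach_open (convex_ball (0 : Y) 1)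
    Metric.isOpen_ball hD
    (Set.disjoint_left.2 fun a ha ha' => by
      have h1 : ‖a‖ < 1 := by simpa using ha
      have h2 : ‖a‖ = 1 := by simpa using hDs ha'
      linarith)
  have hu : 0 < u := by simpa using hfu 0 (by simp)
  have hle : ∀ y : Y, |f y| ≤ u * ‖y‖ := by
    have key : ∀ y : Y, f y ≤ u * ‖y‖ := by
      intro y
      refine le_of_forall_pos_le_add fun ε hε => ?_
      have hpos : 0 < ‖y‖ + ε / u := by positivity
      have := hfu ((‖y‖ + ε / u)⁻¹ • y) (by
        rw [mem_ball_zero_iff, norm_smul, norm_inv, Real.norm_of_nonneg hpos.le,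
          inv_mul_lt_one₀ hpos]
        linarith [div_pos hε hu])
      rw [map_smul, smul_eq_mul, inv_mul_lt_iff₀ hpos, add_mul, div_mul_cancel₀ _ hu.ne'] at this
      linarith
    intro y
    refine abs_le.2 ⟨?_, key y⟩
    have := key (-y)
    rw [map_neg, norm_neg] at this
    linarith
  refine ⟨u⁻¹ • f, ?_, fun d hd => ?_⟩
  · refine ContinuousLinearMap.opNorm_le_bound _ zero_le_one fun y => ?_
    rw [smul_apply, smul_eq_mul, norm_mul, Real.norm_eq_abs, Real.norm_eq_abs,
      abs_of_pos (inv_pos.2 hu), one_mul, inv_mul_le_iff₀ hu]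
    exact hle y
  · have h1 : f d ≤ u := by
      have := (le_abs_self _).trans (hle d)
      rwa [show ‖d‖ = 1 by simpa using hDs hd, mul_one] at this
    rw [smul_apply, smul_eq_mul, le_antisymm h1 (huf d hd),
      inv_mul_cancel₀ hu.ne']

/-- If the midpoint of a segment in the unit ball is at distance two from `-y`, then so are the
endpoints. -/
theorem norm_add_eq_two_of_midpoint {a b y : Y} (ha : ‖a‖ ≤ 1) (hb : ‖b‖ ≤ 1)
    (hy : ‖y‖ ≤ 1) (h : ‖(1 / 2 : ℝ) • a + (1 / 2 : ℝ) • b + y‖ = 2) : ‖a + y‖ = 2 := by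
  refine le_antisymm ((norm_add_le _ _).trans (by linarith)) ?_
  have h1 : (1 / 2 : ℝ) • a + (1 / 2 : ℝ) • b + y
      = (1 / 2 : ℝ) • (a + y) + (1 / 2 : ℝ) • (b + y) := by module
  have h2 := norm_add_le ((1 / 2 : ℝ) • (a + y)) ((1 / 2 : ℝ) • (b + y))
  rw [← h1, h, norm_smul, norm_smul] at h2
  have h3 := norm_add_le b y
  norm_num at h2
  linarith

/-- A maximal convex subset `D` of the unit sphere contains every point `y` of the sphere with
`‖d + y‖ = 2` for all `d ∈ D`. -/
theorem mem_of_maximal_convex {D : Set Y}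
    (hD : Maximal (· ∈ {D : Set Y | Convex ℝ D ∧ D ⊆ Metric.sphere 0 1}) D) (hne : D.Nonempty)
    {y : Y} (hy : ‖y‖ = 1) (h : ∀ d ∈ D, ‖d + y‖ = 2) : y ∈ D := by
  have hle : convexHull ℝ (insert y D) ≤ D := by
    refine hD.2 ⟨convex_convexHull ℝ _, ?_⟩
      ((Set.subset_insert y D).trans (subset_convexHull ℝ _))
    rw [convexHull_insert hne, hD.1.1.convexHull_eq]
    intro z hz
    obtain ⟨d, hd, hz⟩ : ∃ d ∈ D, z ∈ segment ℝ y d := by simpa using hz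
    have hd1 : ‖d‖ = 1 := by simpa using hD.1.2 hd
    obtain ⟨a, b, ha, hb, hab, rfl⟩ := hz
    rw [mem_sphere_zero_iff_norm]
    refine le_antisymm ?_ ?_
    · refine (norm_add_le _ _).trans ?_
      rw [norm_smul, norm_smul, hy, hd1, Real.norm_of_nonneg ha, Real.norm_of_nonneg hb]
      linarith
    · -- `d + y` is the sum of the given point and of its mirror image in the segment
      have h2 : d + y = (a • y + b • d) + (b • y + a • d) := by
        rw [add_add_add_comm, ← add_smul, add_comm (b • d), ← add_smul, hab, one_smul, one_smul,
          add_comm]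
      have h3 := norm_add_le (a • y + b • d) (b • y + a • d)
      have h4 := norm_add_le (b • y) (a • d)
      rw [norm_smul, norm_smul, hy, hd1, Real.norm_of_nonneg ha, Real.norm_of_nonneg hb] at h4
      rw [← h2, h d hd] at h3
      linarith
  exact hle (subset_convexHull ℝ _ (Set.mem_insert _ _))

/-- A convex set of norm-one vectors all of which have distance two from `y` or from `-y` cannot
mix the two alternatives. -/
theorem forall_norm_add_eq_two_or {D : Set Y} (hD : Convex ℝ D) (hDs : D ⊆ Metric.sphere 0 1)
    {y : Y} (hy : ‖y‖ = 1) (h : ∀ d ∈ D, ‖d + y‖ = 2 ∨ ‖d - y‖ = 2) :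
    (∀ d ∈ D, ‖d + y‖ = 2) ∨ ∀ d ∈ D, ‖d + -y‖ = 2 := by
  by_contra! hcon
  obtain ⟨⟨a, ha, ha'⟩, b, hb, hb'⟩ := hcon
  have ha1 : ‖a‖ ≤ 1 := by simpa using (hDs ha).le
  have hb1 : ‖b‖ ≤ 1 := by simpa using (hDs hb).le
  rcases h _ (hD ha hb (a := 1 / 2) (b := 1 / 2) (by norm_num) (by norm_num) (by norm_num))
    with h | h
  · exact ha' (norm_add_eq_two_of_midpoint ha1 hb1 hy.le h)
  · rw [add_comm, sub_eq_add_neg] at h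
    rw [add_comm ((1 / 2 : ℝ) • b)] at h
    refine hb' (norm_add_eq_two_of_midpoint (b := a) hb1 ha1 (by rw [norm_neg, hy]) ?_)
    rwa [add_comm ((1 / 2 : ℝ) • a)] at h

/-- Transfer of a common supporting functional. The relation `max ‖x + w‖ ‖x - w‖ = 2` is
preserved by a surjective phase-isometry in both directions, so a maximal convex subset of the
sphere of `Y` through `T x₀` contains `T x` or `-T x` as soon as everything related to `x₀` is
related to `x`. -/
theorem IsPhaseIsometry.exists_strongDual {T : Metric.sphere (0 : X) 1 → Metric.sphere (0 : Y) 1}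
    (hT : IsPhaseIsometry T) (hsurj : Function.Surjective T) (x₀ : Metric.sphere (0 : X) 1) :
    ∃ f : StrongDual ℝ Y, ‖f‖ ≤ 1 ∧ ∀ x : Metric.sphere (0 : X) 1,
      (∀ w : Metric.sphere (0 : X) 1, max ‖(x₀ : X) + w‖ ‖(x₀ : X) - w‖ = 2 →
        max ‖(x : X) + w‖ ‖(x : X) - w‖ = 2) → |f (T x)| = 1 := by
  obtain ⟨D, hxD, hD⟩ := zorn_subset_nonempty {D : Set Y | Convex ℝ D ∧ D ⊆ Metric.sphere 0 1}
    (fun c hc hchain _ => ⟨⋃₀ c, ⟨hchain.directedOn.convex_sUnion fun A hA => (hc hA).1,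
      Set.sUnion_subset fun A hA => (hc hA).2⟩, fun _ => Set.subset_sUnion_of_mem⟩)
    {(T x₀ : Y)} ⟨convex_singleton _, by simp⟩
  have hx₀ : (T x₀ : Y) ∈ D := hxD rfl
  have hne : D.Nonempty := ⟨_, hx₀⟩
  obtain ⟨f, hf1, hfD⟩ := exists_strongDual_eq_one_of_convex hD.1.1 hD.1.2
  refine ⟨f, hf1, fun x hx => ?_⟩
  have hrel : ∀ d ∈ D, ‖d + T x‖ = 2 ∨ ‖d - T x‖ = 2 := by
    intro d hd
    obtain ⟨w, hw⟩ := hsurj ⟨d, hD.1.2 hd⟩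
    have hwd : (T w : Y) = d := by rw [hw]
    have h2 : ‖(T x₀ : Y) + T w‖ = 2 := by
      refine le_antisymm ((norm_add_le _ _).trans ?_) ?_
      · rw [norm_coe_sphere, norm_coe_sphere]; norm_num
      · have h3 := f.le_opNorm ((T x₀ : Y) + T w)
        rw [map_add, hwd, hfD _ hx₀, hfD _ hd] at h3
        rw [hwd]
        norm_num at h3
        nlinarith [norm_nonneg ((T x₀ : Y) + d)]
    have h3 : max ‖(T x₀ : Y) + T w‖ ‖(T x₀ : Y) - T w‖ = 2 := by
      rw [h2, max_eq_left]
      refine (norm_sub_le _ _).trans ?_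
      rw [norm_coe_sphere, norm_coe_sphere]; norm_num
    rw [hT.max_norm_eq] at h3
    have h4 := hx w h3
    rw [← hT.max_norm_eq, hwd] at h4
    rcases max_choice ‖(T x : Y) + d‖ ‖(T x : Y) - d‖ with h5 | h5
    · left; rw [add_comm, ← h5, h4]
    · right; rw [norm_sub_rev, ← h5, h4]
  rcases forall_norm_add_eq_two_or hD.1.1 hD.1.2 (norm_coe_sphere (T x)) hrel with h | h
  · rw [hfD _ (mem_of_maximal_convex hD hne (norm_coe_sphere _) h), abs_one]
  · have := hfD _ (mem_of_maximal_convex hD hne (by rw [norm_neg, norm_coe_sphere]) h)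
    rw [map_neg] at this
    rw [← abs_neg, this, abs_one]

end Sphere

/-! ### Differences of indicator functions -/

section SignFun

variable {Ω : Type*}

/-- The function equal to `1` on `A`, to `-1` on `B` and to `0` elsewhere, for disjoint `A`
and `B`. -/
noncomputable def signFun (A B : Set Ω) (ω : Ω) : ℝ :=
  A.indicator 1 ω - B.indicator 1 ω

theorem signFun_of_mem_left {A B : Set Ω} (h : Disjoint A B) {ω : Ω} (hω : ω ∈ A) :
    signFun A B ω = 1 := by
  simp [signFun, hω, Set.disjoint_left.1 h hω]

theorem signFun_of_mem_right {A B : Set Ω} (h : Disjoint A B) {ω : Ω} (hω : ω ∈ B) :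
    signFun A B ω = -1 := by
  simp [signFun, hω, Set.disjoint_right.1 h hω]

theorem signFun_of_notMem {A B : Set Ω} {ω : Ω} (hA : ω ∉ A) (hB : ω ∉ B) :
    signFun A B ω = 0 := by
  simp [signFun, hA, hB]

theorem abs_signFun_le (A B : Set Ω) (ω : Ω) : |signFun A B ω| ≤ 1 := by
  by_cases hA : ω ∈ A <;> by_cases hB : ω ∈ B <;> simp [signFun, hA, hB]

end SignFun

/-! ### Limits of bounded functions along ultrafilters -/

section Linfty

variable {Ω : Type*} [MeasurableSpace Ω] {μ : Measure Ω}

theorem Linfty.ae_abs_le_norm (x : Lp ℝ ∞ μ) : ∀ᵐ ω ∂μ, |x ω| ≤ ‖x‖ := by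
  have h := ae_le_eLpNormEssSup (f := (x : Ω → ℝ)) (μ := μ)
  filter_upwards [h] with ω hω
  rw [Lp.norm_def, eLpNorm_exponent_top, ← Real.norm_eq_abs, ← toReal_enorm]
  refine ENNReal.toReal_mono ?_ hω
  rw [← eLpNorm_exponent_top]
  exact (Lp.eLpNorm_lt_top x).ne

theorem Linfty.norm_le {x : Lp ℝ ∞ μ} {c : ℝ} (hc : 0 ≤ c) (h : ∀ᵐ ω ∂μ, |x ω| ≤ c) :
    ‖x‖ ≤ c := by
  rw [Lp.norm_def, eLpNorm_exponent_top]
  exact ENNReal.toReal_le_of_le_ofReal hc (eLpNormEssSup_le_of_ae_bound h)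

theorem Linfty.norm_add_le_of_ae {x y : Lp ℝ ∞ μ} {c : ℝ} (hc : 0 ≤ c)
    (h : ∀ᵐ ω ∂μ, |x ω + y ω| ≤ c) : ‖x + y‖ ≤ c := by
  refine Linfty.norm_le hc ?_
  filter_upwards [h, Lp.coeFn_add x y] with ω h1 h2
  rwa [h2]

theorem Linfty.norm_sub_le_of_ae {x y : Lp ℝ ∞ μ} {c : ℝ} (hc : 0 ≤ c)
    (h : ∀ᵐ ω ∂μ, |x ω - y ω| ≤ c) : ‖x - y‖ ≤ c := by
  refine Linfty.norm_le hc ?_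
  filter_upwards [h, Lp.coeFn_sub x y] with ω h1 h2
  rwa [h2]

variable (μ) in
/-- The ultrafilters containing all conull sets. They play the role of the points of the compact
space `K` in an identification of `L^∞(μ)` with `C(K)`. -/
abbrev AEUltrafilter : Type _ := {U : Ultrafilter Ω // (U : Filter Ω) ≤ ae μ}

namespace AEUltrafilter

/-- The value of an essentially bounded function at an ultrafilter: its limit. -/
noncomputable def value (U : AEUltrafilter μ) (x : Lp ℝ ∞ μ) : ℝ :=
  limUnder (U.1 : Filter Ω) (x : Ω → ℝ)

variable (U : AEUltrafilter μ)

theorem eventually_of_ae {p : Ω → Prop} (h : ∀ᵐ ω ∂μ, p ω) : ∀ᶠ ω in (U.1 : Filter Ω), p ω :=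
  U.2 h

theorem tendsto_value (x : Lp ℝ ∞ μ) : Tendsto (x : Ω → ℝ) U.1 (𝓝 (U.value x)) := by
  have hx : Set.Icc (-‖x‖) ‖x‖ ∈ U.1.map (x : Ω → ℝ) := by
    refine Ultrafilter.mem_map.2 (U.2 ?_)
    filter_upwards [Linfty.ae_abs_le_norm x] with ω hω
    exact abs_le.1 hω
  obtain ⟨t, -, ht⟩ := isCompact_Icc.ultrafilter_le_nhds' _ hx
  have ht' : Tendsto (x : Ω → ℝ) U.1 (𝓝 t) := ht
  rwa [value, ht'.limUnder_eq]

variable {U}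

theorem value_eq_of_tendsto {x : Lp ℝ ∞ μ} {t : ℝ} (h : Tendsto (x : Ω → ℝ) U.1 (𝓝 t)) :
    U.value x = t :=
  h.limUnder_eq

theorem value_eq_of_eventually {x : Lp ℝ ∞ μ} {t : ℝ} (h : ∀ᶠ ω in (U.1 : Filter Ω), x ω = t) :
    U.value x = t :=
  value_eq_of_tendsto (tendsto_const_nhds.congr' (h.mono fun _ h => h.symm))

theorem value_add (x y : Lp ℝ ∞ μ) : U.value (x + y) = U.value x + U.value y :=
  value_eq_of_tendsto <| ((U.tendsto_value x).add (U.tendsto_value y)).congr'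
    ((U.eventually_of_ae (Lp.coeFn_add x y)).mono fun _ h => h.symm)

theorem value_smul (c : ℝ) (x : Lp ℝ ∞ μ) : U.value (c • x) = c * U.value x :=
  value_eq_of_tendsto <| ((U.tendsto_value x).const_mul c).congr'
    ((U.eventually_of_ae (Lp.coeFn_smul c x)).mono fun _ h => h.symm)

theorem value_neg (x : Lp ℝ ∞ μ) : U.value (-x) = -U.value x := by
  rw [← neg_one_smul ℝ x, value_smul, neg_one_mul]

theorem abs_value_le (x : Lp ℝ ∞ μ) : |U.value x| ≤ ‖x‖ :=
  le_of_tendsto (U.tendsto_value x).abs (U.2 (Linfty.ae_abs_le_norm x))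

/-- The values at ultrafilters separate the points of `L^∞(μ)`. -/
theorem eq_zero_of_forall_value {x : Lp ℝ ∞ μ} (h : ∀ U : AEUltrafilter μ, U.value x = 0) :
    x = 0 := by
  by_contra hx
  have hx' : 0 < ‖x‖ := norm_pos_iff.2 hx
  have hfr : ∃ᶠ ω in ae μ, ‖x‖ / 2 < |x ω| := by
    intro hev
    have := Linfty.norm_le (x := x) (half_pos hx').le (hev.mono fun ω hω => not_lt.1 hω)
    linarith
  have := frequently_iff_neBot.1 hfr
  obtain ⟨U, hU⟩ := Ultrafilter.exists_le (ae μ ⊓ 𝓟 {ω | ‖x‖ / 2 < |x ω|})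
  have hmem : ∀ᶠ ω in (U : Filter Ω), ‖x‖ / 2 < |x ω| := le_principal_iff.1 (hU.trans inf_le_right)
  have h1 := ge_of_tendsto (tendsto_value ⟨U, hU.trans inf_le_left⟩ x).abs
    (hmem.mono fun ω hω => hω.le)
  rw [h, abs_zero] at h1
  linarith

/-- A function bounded by one, and of modulus one on some member of `U`, has norm one in
`L^∞(μ)`. -/
theorem exists_sphere {g : Ω → ℝ} (hg : StronglyMeasurable g) (hb : ∀ᵐ ω ∂μ, |g ω| ≤ 1)
    (hU : ∀ᶠ ω in (U.1 : Filter Ω), |g ω| = 1) :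
    ∃ y : Metric.sphere (0 : Lp ℝ ∞ μ) 1, (y : Lp ℝ ∞ μ) =ᵐ[μ] g := by
  have hm : MemLp g ∞ μ := memLp_top_of_bound hg.aestronglyMeasurable 1 hb
  refine ⟨⟨hm.toLp g, ?_⟩, hm.coeFn_toLp⟩
  rw [mem_sphere_zero_iff_norm]
  refine le_antisymm (Linfty.norm_le zero_le_one ?_) ?_
  · filter_upwards [hm.coeFn_toLp, hb] with ω h1 h2
    rwa [h1]
  · obtain ⟨ω, h1, h2, h3⟩ := (hU.and ((U.eventually_of_ae hm.coeFn_toLp).and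
      (U.eventually_of_ae (Linfty.ae_abs_le_norm (hm.toLp g))))).exists
    rwa [h2, h1] at h3

end AEUltrafilter

theorem Linfty.ae_abs_le_one (x : Metric.sphere (0 : Lp ℝ ∞ μ) 1) :
    ∀ᵐ ω ∂μ, |(x : Lp ℝ ∞ μ) ω| ≤ 1 := by
  have := Linfty.ae_abs_le_norm (x : Lp ℝ ∞ μ)
  rwa [norm_coe_sphere] at this

theorem stronglyMeasurable_signFun {A B : Set Ω} (hA : MeasurableSet A) (hB : MeasurableSet B) :
    StronglyMeasurable (signFun A B) :=
  (stronglyMeasurable_one.indicator hA).sub (stronglyMeasurable_one.indicator hB)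

namespace AEUltrafilter

variable {U : AEUltrafilter μ} {A B : Set Ω}

theorem exists_sphere_signFun (hA : MeasurableSet A) (hB : MeasurableSet B) (h : Disjoint A B)
    (hU : A ∪ B ∈ U.1) :
    ∃ y : Metric.sphere (0 : Lp ℝ ∞ μ) 1, (y : Lp ℝ ∞ μ) =ᵐ[μ] signFun A B := by
  refine exists_sphere (U := U) (stronglyMeasurable_signFun hA hB)
    (Eventually.of_forall (abs_signFun_le A B)) ?_
  filter_upwards [hU] with ω hω
  rcases hω with hω | hω
  · rw [signFun_of_mem_left h hω, abs_one]
  · rw [signFun_of_mem_right h hω, abs_neg, abs_one]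

theorem value_signFun_left {z : Lp ℝ ∞ μ} (hz : z =ᵐ[μ] signFun A B) (h : Disjoint A B)
    (hU : A ∈ U.1) : U.value z = 1 := by
  refine value_eq_of_eventually ?_
  filter_upwards [U.2 hz, hU] with ω h1 h2
  rw [h1, signFun_of_mem_left h h2]

theorem value_signFun_right {z : Lp ℝ ∞ μ} (hz : z =ᵐ[μ] signFun A B) (h : Disjoint A B)
    (hU : B ∈ U.1) : U.value z = -1 := by
  refine value_eq_of_eventually ?_
  filter_upwards [U.2 hz, hU] with ω h1 h2
  rw [h1, signFun_of_mem_right h h2]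

theorem value_signFun_of_notMem {z : Lp ℝ ∞ μ} (hz : z =ᵐ[μ] signFun A B)
    (hA : A ∉ U.1) (hB : B ∉ U.1) : U.value z = 0 := by
  refine value_eq_of_eventually ?_
  filter_upwards [U.2 hz, Ultrafilter.compl_mem_iff_notMem.2 hA,
    Ultrafilter.compl_mem_iff_notMem.2 hB] with ω h1 h2 h3
  rw [h1, signFun_of_notMem h2 h3]

end AEUltrafilter

end Linfty

/-! ### Functionals attached to ultrafilters -/

section Functional

variable {Ω : Type*} [MeasurableSpace Ω] {μ : Measure Ω}
  {Y : Type*} [NormedAddCommGroup Y] [NormedSpace ℝ Y]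
  {T : Metric.sphere (0 : Lp ℝ ∞ μ) 1 → Metric.sphere (0 : Y) 1}

theorem abs_apply_le_of_norm_le_one {f : StrongDual ℝ Y} (hf : ‖f‖ ≤ 1) (y : Y) : |f y| ≤ ‖y‖ := by
  have := f.le_of_opNorm_le hf y
  rwa [one_mul] at this

/-- If `x = 1` on `A`, then every `w` at distance two from the indicator function of `A` or from
its negative is at distance two from `x` or from `-x`, since off `A` the sum `1_A ± w` is bounded by
one. Hence all such `x` have images with a common supporting functional, up to sign. -/
theorem exists_strongDual_of_measurableSet (hT : IsPhaseIsometry T) (hsurj : Function.Surjective T)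
    {U : AEUltrafilter μ} {A : Set Ω} (hA : MeasurableSet A) (hAU : A ∈ U.1) :
    ∃ f : StrongDual ℝ Y, ‖f‖ ≤ 1 ∧ ∀ x : Metric.sphere (0 : Lp ℝ ∞ μ) 1,
      (∀ᵐ ω ∂μ, ω ∈ A → (x : Lp ℝ ∞ μ) ω = 1) → |f (T x)| = 1 := by
  obtain ⟨a, ha⟩ := AEUltrafilter.exists_sphere_signFun hA MeasurableSet.empty
    (Set.disjoint_empty A) (by simpa using hAU)
  obtain ⟨f, hf, hfa⟩ := hT.exists_strongDual hsurj a
  refine ⟨f, hf, fun x hx => hfa x fun w hw => ?_⟩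
  have hadd : ‖(a : Lp ℝ ∞ μ) + w‖ ≤ max 1 ‖(x : Lp ℝ ∞ μ) + w‖ := by
    refine Linfty.norm_add_le_of_ae (by positivity) ?_
    filter_upwards [ha, hx, Linfty.ae_abs_le_one w,
      Linfty.ae_abs_le_norm ((x : Lp ℝ ∞ μ) + (w : Lp ℝ ∞ μ)),
      Lp.coeFn_add (x : Lp ℝ ∞ μ) (w : Lp ℝ ∞ μ)] with ω h1 h2 h3 h4 h5
    rw [h5, Pi.add_apply] at h4
    by_cases hω : ω ∈ A
    · rw [h2 hω] at h4
      rw [h1, signFun_of_mem_left (Set.disjoint_empty A) hω]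
      exact h4.trans (le_max_right _ _)
    · rw [h1, signFun_of_notMem hω (Set.notMem_empty _), zero_add]
      exact h3.trans (le_max_left _ _)
  have hsub : ‖(a : Lp ℝ ∞ μ) - w‖ ≤ max 1 ‖(x : Lp ℝ ∞ μ) - w‖ := by
    refine Linfty.norm_sub_le_of_ae (by positivity) ?_
    filter_upwards [ha, hx, Linfty.ae_abs_le_one w,
      Linfty.ae_abs_le_norm ((x : Lp ℝ ∞ μ) - (w : Lp ℝ ∞ μ)),
      Lp.coeFn_sub (x : Lp ℝ ∞ μ) (w : Lp ℝ ∞ μ)] with ω h1 h2 h3 h4 h5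
    rw [h5, Pi.sub_apply] at h4
    by_cases hω : ω ∈ A
    · rw [h2 hω] at h4
      rw [h1, signFun_of_mem_left (Set.disjoint_empty A) hω]
      exact h4.trans (le_max_right _ _)
    · rw [h1, signFun_of_notMem hω (Set.notMem_empty _), zero_sub, abs_neg]
      exact h3.trans (le_max_left _ _)
  have hle := norm_add_le (x : Lp ℝ ∞ μ) w
  have hle' := norm_sub_le (x : Lp ℝ ∞ μ) w
  rw [norm_coe_sphere, norm_coe_sphere] at hle hle'
  refine le_antisymm (max_le (by linarith) (by linarith)) ?_
  have h2 : (2 : ℝ) ≤ max 1 (max ‖(x : Lp ℝ ∞ μ) + w‖ ‖(x : Lp ℝ ∞ μ) - w‖) := by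
    rw [← hw]
    exact max_le (hadd.trans (max_le_max_left _ (le_max_left _ _)))
      (hsub.trans (max_le_max_left _ (le_max_right _ _)))
  exact (le_max_iff.1 h2).resolve_left (by norm_num)

/-- The functionals of `exists_strongDual_of_measurableSet` accumulate, by weak-star compactness,
as `A` shrinks along `U`. -/
theorem exists_strongDual_abs_eq_one (hT : IsPhaseIsometry T) (hsurj : Function.Surjective T)
    (U : AEUltrafilter μ) :
    ∃ f : StrongDual ℝ Y, ‖f‖ ≤ 1 ∧ ∀ x : Metric.sphere (0 : Lp ℝ ∞ μ) 1,
      (∀ᶠ ω in (U.1 : Filter Ω), (x : Lp ℝ ∞ μ) ω = 1) → |f (T x)| = 1 := by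
  let I := {A : Set Ω // MeasurableSet A ∧ A ∈ U.1}
  have : Nonempty I := ⟨⟨Set.univ, MeasurableSet.univ, univ_mem⟩⟩
  let C : I → Set (WeakDual ℝ Y) := fun A =>
    (WeakDual.toStrongDual ⁻¹' Metric.closedBall 0 1) ∩
      ⋂ x : {x : Metric.sphere (0 : Lp ℝ ∞ μ) 1 // ∀ᵐ ω ∂μ, ω ∈ A.1 → (x : Lp ℝ ∞ μ) ω = 1},
        {f : WeakDual ℝ Y | |f (T x)| = 1}
  have hclosed : ∀ A : Set Ω, IsClosed (⋂ x : {x : Metric.sphere (0 : Lp ℝ ∞ μ) 1 //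
      ∀ᵐ ω ∂μ, ω ∈ A → (x : Lp ℝ ∞ μ) ω = 1}, {f : WeakDual ℝ Y | |f (T x)| = 1}) := fun A =>
    isClosed_iInter fun x => isClosed_eq (WeakDual.eval_continuous _).abs continuous_const
  have hanti : ∀ A B : I, A.1 ⊆ B.1 → C A ⊆ C B := fun A B hAB f hf =>
    ⟨hf.1, Set.mem_iInter.2 fun x => Set.mem_iInter.1 hf.2
      ⟨x.1, x.2.mono fun ω h hω => h (hAB hω)⟩⟩
  obtain ⟨f, hf⟩ := IsCompact.nonempty_iInter_of_directed_nonempty_isCompact_isClosed C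
    (fun A B => ⟨⟨A.1 ∩ B.1, A.2.1.inter B.2.1, inter_mem A.2.2 B.2.2⟩,
      hanti _ _ Set.inter_subset_left, hanti _ _ Set.inter_subset_right⟩)
    (fun A => by
      obtain ⟨f, hf1, hf⟩ := exists_strongDual_of_measurableSet hT hsurj A.2.1 A.2.2
      refine ⟨StrongDual.toWeakDual f, ?_, Set.mem_iInter.2 fun x => hf x.1 x.2⟩
      simpa using hf1)
    (fun A => (WeakDual.isCompact_closedBall _ _).inter_right (hclosed A.1))
    (fun A => (WeakDual.isClosed_closedBall _ _).inter (hclosed A.1))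
  rw [Set.mem_iInter] at hf
  refine ⟨WeakDual.toStrongDual f, by simpa using (hf (Classical.arbitrary I)).1, fun x hx => ?_⟩
  let A : I := ⟨{ω | (x : Lp ℝ ∞ μ) ω = 1},
    (Lp.stronglyMeasurable (x : Lp ℝ ∞ μ)).measurable (measurableSet_singleton 1), hx⟩
  exact Set.mem_iInter.1 (hf A).2 ⟨x, Eventually.of_forall fun ω h => h⟩

/-- A functional of modulus one at `T x` whenever `x = 1` on a member of `U` computes, up to sign,
the value at `U`: perturb `x` near `U` to a function equal to `1` there for the lower bound, and
compare `x` with an indicator function for the upper bound. -/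
theorem abs_apply_eq_abs_value (hT : IsPhaseIsometry T) (hsurj : Function.Surjective T)
    {U : AEUltrafilter μ} {f : StrongDual ℝ Y} (hf : ‖f‖ ≤ 1)
    (hfU : ∀ x : Metric.sphere (0 : Lp ℝ ∞ μ) 1,
      (∀ᶠ ω in (U.1 : Filter Ω), (x : Lp ℝ ∞ μ) ω = 1) → |f (T x)| = 1)
    (x : Metric.sphere (0 : Lp ℝ ∞ μ) 1) : |f (T x)| = |U.value x| := by
  wlog ht : 0 ≤ U.value x generalizing x
  · have := this (-x) (by
      rw [show ((-x : Metric.sphere (0 : Lp ℝ ∞ μ) 1) : Lp ℝ ∞ μ) = -x from rfl,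
        AEUltrafilter.value_neg]
      linarith)
    rwa [hT.apply_neg hsurj, show ((-x : Metric.sphere (0 : Lp ℝ ∞ μ) 1) : Lp ℝ ∞ μ) = -x from rfl,
      AEUltrafilter.value_neg, map_neg, abs_neg, abs_neg] at this
  rw [abs_of_nonneg ht]
  have ht1 : U.value x ≤ 1 := by
    have := (le_abs_self _).trans (AEUltrafilter.abs_value_le (U := U) (x : Lp ℝ ∞ μ))
    rwa [norm_coe_sphere] at this
  have key : ∀ δ > 0, |(|f (T x)| - U.value x)| ≤ δ := by
    intro δ hδ
    set t := U.value x with ht_def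
    let A : Set Ω := {ω | |(x : Lp ℝ ∞ μ) ω - t| < δ}
    have hxm : StronglyMeasurable (x : Lp ℝ ∞ μ) := Lp.stronglyMeasurable _
    have hA : MeasurableSet A :=
      measurableSet_lt (hxm.measurable.sub_const t).abs measurable_const
    have hAU : A ∈ U.1 := by
      have := (U.tendsto_value x).eventually (Metric.ball_mem_nhds _ hδ)
      exact this
    have hx1 := Linfty.ae_abs_le_one x
    rw [abs_le]
    constructor
    · classical
      obtain ⟨y, hy⟩ := AEUltrafilter.exists_sphere (U := U)
        (g := A.piecewise (fun _ => 1) (x : Lp ℝ ∞ μ))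
        (stronglyMeasurable_const.piecewise hA hxm)
        (by
          filter_upwards [hx1] with ω hω
          by_cases h : ω ∈ A <;> simp [h, hω])
        (by
          filter_upwards [hAU] with ω h
          simp [h])
      have hfy : |f (T y)| = 1 := by
        refine hfU y ?_
        filter_upwards [U.eventually_of_ae hy, hAU] with ω h h'
        rw [h, Set.piecewise_eq_of_mem _ _ _ h']
      have hxy : ‖(x : Lp ℝ ∞ μ) - y‖ ≤ 1 - t + δ := by
        refine Linfty.norm_sub_le_of_ae (by linarith) ?_
        filter_upwards [hy, hx1] with ω h h'
        by_cases hω : ω ∈ A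
        · rw [h, Set.piecewise_eq_of_mem _ _ _ hω, abs_le]
          have := abs_lt.1 (show |(x : Lp ℝ ∞ μ) ω - t| < δ from hω)
          have := abs_le.1 h'
          constructor <;> linarith
        · rw [h, Set.piecewise_eq_of_notMem _ _ _ hω, sub_self, abs_zero]
          linarith
      have : ∃ s : ℝ, |s| = 1 ∧ |f (T x) + s * f (T y)| ≤ 1 - t + δ := by
        rcases hT.norm_eq_or x y with ⟨-, h⟩ | ⟨h, -⟩
        · refine ⟨-1, by simp, ?_⟩
          have h1 := abs_apply_le_of_norm_le_one hf ((T x : Y) - T y)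
          rw [map_sub, h] at h1
          rw [neg_one_mul, ← sub_eq_add_neg]
          exact h1.trans hxy
        · refine ⟨1, by simp, ?_⟩
          have h1 := abs_apply_le_of_norm_le_one hf ((T x : Y) + T y)
          rw [map_add, h] at h1
          rw [one_mul]
          exact h1.trans hxy
      obtain ⟨s, hs, h⟩ := this
      have h2 := abs_sub_abs_le_abs_sub (s * f (T y)) (-f (T x))
      rw [abs_mul, hs, hfy, abs_neg, sub_neg_eq_add, add_comm (s * f (T y))] at h2
      linarith
    · obtain ⟨y, hy⟩ := AEUltrafilter.exists_sphere_signFun hA MeasurableSet.empty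
        (Set.disjoint_empty A) (by simpa using hAU)
      have hfy : |f (T y)| = 1 := by
        refine hfU y ?_
        filter_upwards [U.eventually_of_ae hy, hAU] with ω h h'
        rw [h, signFun_of_mem_left (Set.disjoint_empty A) h']
      have hadd : ‖(x : Lp ℝ ∞ μ) + y‖ ≤ 1 + t + δ := by
        refine Linfty.norm_add_le_of_ae (by linarith) ?_
        filter_upwards [hy, hx1] with ω h h'
        have h'' := abs_le.1 h'
        by_cases hω : ω ∈ A
        · rw [h, signFun_of_mem_left (Set.disjoint_empty A) hω, abs_le]
          have := abs_lt.1 (show |(x : Lp ℝ ∞ μ) ω - t| < δ from hω)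
          constructor <;> linarith
        · rw [h, signFun_of_notMem hω (Set.notMem_empty _), add_zero]
          linarith
      have hsub : ‖(x : Lp ℝ ∞ μ) - y‖ ≤ 1 + t + δ := by
        refine Linfty.norm_sub_le_of_ae (by linarith) ?_
        filter_upwards [hy, hx1] with ω h h'
        have h'' := abs_le.1 h'
        by_cases hω : ω ∈ A
        · rw [h, signFun_of_mem_left (Set.disjoint_empty A) hω, abs_le]
          have := abs_lt.1 (show |(x : Lp ℝ ∞ μ) ω - t| < δ from hω)
          constructor <;> linarith
        · rw [h, signFun_of_notMem hω (Set.notMem_empty _), sub_zero]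
          linarith
      have hmax := max_le hadd hsub
      rw [← hT.max_norm_eq, max_le_iff] at hmax
      have h1 := (abs_apply_le_of_norm_le_one hf _).trans hmax.1
      have h2 := (abs_apply_le_of_norm_le_one hf _).trans hmax.2
      rw [map_add] at h1
      rw [map_sub] at h2
      rw [abs_le] at h1 h2
      rcases abs_cases (f (T x)) with ⟨h3, -⟩ | ⟨h3, -⟩ <;>
        rcases abs_cases (f (T y)) with ⟨h4, -⟩ | ⟨h4, -⟩ <;> rw [h3] <;> rw [h4] at hfy <;>
        linarith
  have h0 : |(|f (T x)| - U.value x)| ≤ 0 :=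
    le_of_forall_pos_le_add fun ε hε => by simpa using key ε hε
  exact sub_eq_zero.1 (abs_nonpos_iff.1 h0)

/-- A choice of functionals `f U` in the unit ball of the dual of `Y`, one for each ultrafilter,
with `f U (T x) = ± U.value x` on the sphere and with the positive sign at the constant
function `1`. -/
structure IsValueSystem (T : Metric.sphere (0 : Lp ℝ ∞ μ) 1 → Metric.sphere (0 : Y) 1)
    (f : AEUltrafilter μ → StrongDual ℝ Y) : Prop where
  norm_le (U : AEUltrafilter μ) : ‖f U‖ ≤ 1
  abs_apply (U : AEUltrafilter μ) (x : Metric.sphere (0 : Lp ℝ ∞ μ) 1) :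
    |f U (T x)| = |U.value x|
  apply_one (U : AEUltrafilter μ) {e : Metric.sphere (0 : Lp ℝ ∞ μ) 1}
    (he : (e : Lp ℝ ∞ μ) =ᵐ[μ] signFun Set.univ ∅) : f U (T e) = 1

theorem exists_isValueSystem (hT : IsPhaseIsometry T) (hsurj : Function.Surjective T) :
    ∃ f, IsValueSystem T f := by
  have key : ∀ U : AEUltrafilter μ, ∃ f : StrongDual ℝ Y, ‖f‖ ≤ 1 ∧
      (∀ x : Metric.sphere (0 : Lp ℝ ∞ μ) 1, |f (T x)| = |U.value x|) ∧
      ∀ e : Metric.sphere (0 : Lp ℝ ∞ μ) 1, (e : Lp ℝ ∞ μ) =ᵐ[μ] signFun Set.univ ∅ →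
        f (T e) = 1 := by
    intro U
    obtain ⟨f, hf, hfU⟩ := exists_strongDual_abs_eq_one hT hsurj U
    have hval := abs_apply_eq_abs_value hT hsurj hf hfU
    obtain ⟨e, he⟩ := AEUltrafilter.exists_sphere_signFun (U := U) MeasurableSet.univ
      MeasurableSet.empty (Set.disjoint_empty _)
      (by rw [Set.union_empty]; exact univ_mem)
    have huniq : ∀ e' : Metric.sphere (0 : Lp ℝ ∞ μ) 1,
        (e' : Lp ℝ ∞ μ) =ᵐ[μ] signFun Set.univ ∅ → e' = e := fun e' he' =>
      Subtype.ext (Lp.ext (he'.trans he.symm))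
    have h1 : |f (T e)| = 1 := by
      rw [hval, AEUltrafilter.value_signFun_left he (Set.disjoint_empty _) univ_mem, abs_one]
    rcases eq_or_eq_neg_of_abs_eq h1 with h | h
    · exact ⟨f, hf, hval, fun e' he' => by rw [huniq e' he', h]⟩
    · exact ⟨-f, by rwa [norm_neg], fun x => by rw [neg_apply, abs_neg, hval],
        fun e' he' => by rw [huniq e' he', neg_apply, h, neg_neg]⟩
  choose f hf using key
  exact ⟨f, fun U => (hf U).1, fun U => (hf U).2.1, fun U e he => (hf U).2.2 e he⟩

end Functional

/-! ### Coherence of the signs -/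

section Sign

variable {Ω : Type*} [MeasurableSpace Ω] {μ : Measure Ω}
  {Y : Type*} [NormedAddCommGroup Y] [NormedSpace ℝ Y]
  {T : Metric.sphere (0 : Lp ℝ ∞ μ) 1 → Metric.sphere (0 : Y) 1}
  {f : AEUltrafilter μ → StrongDual ℝ Y}

/-- The functionals `f U` see `T x` as a single multiple `± x`, with a sign not depending on the
ultrafilter. -/
def HasCoherentSign (T : Metric.sphere (0 : Lp ℝ ∞ μ) 1 → Metric.sphere (0 : Y) 1)
    (f : AEUltrafilter μ → StrongDual ℝ Y) (x : Metric.sphere (0 : Lp ℝ ∞ μ) 1) : Prop :=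
  ∃ σ : ℝ, (σ = 1 ∨ σ = -1) ∧ ∀ U, f U (T x) = σ * U.value x

namespace IsValueSystem

/-- By surjectivity, every vector of `Y` is a multiple of some `T w`. -/
theorem eq_zero_of_forall_apply (hf : IsValueSystem T f) (hsurj : Function.Surjective T) {y : Y}
    (h : ∀ U, f U y = 0) : y = 0 := by
  by_contra hy
  obtain ⟨w, hw⟩ := exists_eq_norm_smul_of_surjective hsurj hy
  have hw0 : (w : Lp ℝ ∞ μ) = 0 := by
    refine AEUltrafilter.eq_zero_of_forall_value fun U => ?_
    have h1 := h U
    rw [hw, map_smul, smul_eq_mul] at h1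
    have h2 := (mul_eq_zero.1 h1).resolve_left (norm_ne_zero_iff.2 hy)
    rw [← abs_eq_zero, ← hf.abs_apply, h2, abs_zero]
  have h1 := norm_coe_sphere w
  rw [hw0, norm_zero] at h1
  exact zero_ne_one h1

theorem hasCoherentSign_of_forall (hf : IsValueSystem T f) {x : Metric.sphere (0 : Lp ℝ ∞ μ) 1}
    (h : ∀ U V : AEUltrafilter μ, U.value x ≠ 0 → V.value x ≠ 0 → f U (T x) = U.value x →
      f V (T x) = -V.value x → False) : HasCoherentSign T f x := by
  have hor : ∀ U : AEUltrafilter μ, f U (T x) = U.value x ∨ f U (T x) = -U.value x := fun U =>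
    abs_eq_abs.1 (hf.abs_apply U x)
  by_cases hex : ∃ U : AEUltrafilter μ, U.value x ≠ 0 ∧ f U (T x) = U.value x
  · obtain ⟨U, hU, hU'⟩ := hex
    refine ⟨1, Or.inl rfl, fun V => ?_⟩
    rw [one_mul]
    rcases hor V with hV | hV
    · exact hV
    · by_cases h0 : V.value x = 0
      · rw [hV, h0, neg_zero]
      · exact (h U V hU h0 hU' hV).elim
  · refine ⟨-1, Or.inr rfl, fun V => ?_⟩
    rw [neg_one_mul]
    rcases hor V with hV | hV
    · by_cases h0 : V.value x = 0
      · rw [hV, h0, neg_zero]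
      · exact (hex ⟨V, h0, hV⟩).elim
    · exact hV

/-- Comparison with a test vector `z`. If the signs of `T x` at `U` and `V` disagreed, then `T x`
would have distance greater than one from both `T z` and `-T z`, whereas `‖x - z‖ ≤ 1`. -/
theorem false_of_test (hf : IsValueSystem T f) (hT : IsPhaseIsometry T)
    {x z : Metric.sphere (0 : Lp ℝ ∞ μ) 1} (hxz : ‖(x : Lp ℝ ∞ μ) - z‖ ≤ 1)
    (hz : HasCoherentSign T f z) {U V : AEUltrafilter μ}
    (hU : |U.value z| = 1) (hV : |V.value z| = 1) (hxU : 0 < U.value x * U.value z)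
    (hxV : 0 < V.value x * V.value z) (hTU : f U (T x) = U.value x)
    (hTV : f V (T x) = -V.value x) : False := by
  obtain ⟨σ, hσ, hz⟩ := hz
  have habs : ∀ s t : ℝ, |t| = 1 → 0 < s * t → 1 < |s + t| := by
    intro s t ht hst
    rcases eq_or_eq_neg_of_abs_eq ht with rfl | rfl
    · rw [abs_of_pos] <;> linarith
    · rw [abs_of_neg] <;> linarith
  have hle : ‖(T x : Y) + T z‖ ≤ 1 ∨ ‖(T x : Y) - T z‖ ≤ 1 := by
    rcases hT.norm_eq_or x z with ⟨-, h⟩ | ⟨h, -⟩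
    · right; rwa [h]
    · left; rwa [h]
  have hTzU := hz U
  have hTzV := hz V
  rcases hle with h | h <;> have h1 := (abs_apply_le_of_norm_le_one (hf.norm_le U) _).trans h <;>
    have h2 := (abs_apply_le_of_norm_le_one (hf.norm_le V) _).trans h <;>
    simp only [map_add, map_sub, hTU, hTV, hTzU, hTzV] at h1 h2 <;>
    rcases hσ with rfl | rfl
  · rw [one_mul] at h1
    exact (habs _ _ hU hxU).not_ge h1
  · rw [neg_one_mul, ← neg_add, abs_neg] at h2
    exact (habs _ _ hV hxV).not_ge h2
  · rw [one_mul, ← neg_add', abs_neg] at h2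
    exact (habs _ _ hV hxV).not_ge h2
  · rw [neg_one_mul, sub_neg_eq_add] at h1
    exact (habs _ _ hU hxU).not_ge h1

theorem hasCoherentSign_one (hf : IsValueSystem T f) {e : Metric.sphere (0 : Lp ℝ ∞ μ) 1}
    (he : (e : Lp ℝ ∞ μ) =ᵐ[μ] signFun Set.univ ∅) : HasCoherentSign T f e := by
  refine ⟨1, Or.inl rfl, fun U => ?_⟩
  rw [hf.apply_one U he, AEUltrafilter.value_signFun_left he (Set.disjoint_empty _) univ_mem,
    one_mul]

/-- Indicator functions are tested against the constant function `1`. -/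
theorem hasCoherentSign_indicator (hf : IsValueSystem T f) (hT : IsPhaseIsometry T)
    {A : Set Ω} {a : Metric.sphere (0 : Lp ℝ ∞ μ) 1}
    (ha : (a : Lp ℝ ∞ μ) =ᵐ[μ] signFun A ∅) : HasCoherentSign T f a := by
  refine hf.hasCoherentSign_of_forall fun U V hU hV hTU hTV => ?_
  obtain ⟨e, he⟩ := AEUltrafilter.exists_sphere_signFun (U := U) MeasurableSet.univ
    MeasurableSet.empty (Set.disjoint_empty _) (by rw [Set.union_empty]; exact univ_mem)
  have hval : ∀ W : AEUltrafilter μ, W.value a ≠ 0 → W.value a = 1 := fun W hW => by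
    by_cases hAW : A ∈ W.1
    · exact AEUltrafilter.value_signFun_left ha (Set.disjoint_empty _) hAW
    · exact (hW (AEUltrafilter.value_signFun_of_notMem ha hAW W.1.empty_notMem)).elim
  have hone : ∀ W : AEUltrafilter μ, W.value e = 1 := fun W =>
    AEUltrafilter.value_signFun_left he (Set.disjoint_empty _) univ_mem
  refine hf.false_of_test hT (z := e) ?_ (hf.hasCoherentSign_one he) (by rw [hone, abs_one])
    (by rw [hone, abs_one]) (by rw [hval U hU, hone]; norm_num) (by rw [hval V hV, hone]; norm_num)
    hTU hTV
  refine Linfty.norm_sub_le_of_ae zero_le_one ?_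
  filter_upwards [ha, he] with ω h1 h2
  rw [h1, h2, signFun_of_mem_left (Set.disjoint_empty _) (Set.mem_univ ω)]
  by_cases hω : ω ∈ A
  · simp [signFun_of_mem_left (Set.disjoint_empty _) hω]
  · simp [signFun_of_notMem hω (Set.notMem_empty _)]

section TwoSets

variable {A B : Set Ω} {z : Metric.sphere (0 : Lp ℝ ∞ μ) 1}

/-- The sign of `T (1_A - 1_B)` is constant on `A`, by comparison with `1_A`. -/
theorem false_of_mem_left (hf : IsValueSystem T f) (hT : IsPhaseIsometry T)
    (hA : MeasurableSet A) (hAB : Disjoint A B)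
    (hz : (z : Lp ℝ ∞ μ) =ᵐ[μ] signFun A B) {U V : AEUltrafilter μ} (hU : A ∈ U.1) (hV : A ∈ V.1)
    (hTU : f U (T z) = U.value z) (hTV : f V (T z) = -V.value z) : False := by
  obtain ⟨a, ha⟩ := AEUltrafilter.exists_sphere_signFun (U := U) hA
    MeasurableSet.empty (Set.disjoint_empty _) (by rwa [Set.union_empty])
  have hzU := AEUltrafilter.value_signFun_left hz hAB hU
  have hzV := AEUltrafilter.value_signFun_left hz hAB hV
  have haU := AEUltrafilter.value_signFun_left ha (Set.disjoint_empty _) hU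
  have haV := AEUltrafilter.value_signFun_left ha (Set.disjoint_empty _) hV
  refine hf.false_of_test hT (z := a) ?_ (hf.hasCoherentSign_indicator hT ha)
    (by rw [haU, abs_one]) (by rw [haV, abs_one]) (by rw [hzU, haU]; norm_num)
    (by rw [hzV, haV]; norm_num) hTU hTV
  refine Linfty.norm_sub_le_of_ae zero_le_one ?_
  filter_upwards [ha, hz] with ω h1 h2
  rw [h1, h2]
  by_cases hω : ω ∈ A
  · simp [signFun_of_mem_left (Set.disjoint_empty _) hω, signFun_of_mem_left hAB hω]
  · rw [signFun_of_notMem hω (Set.notMem_empty _), sub_zero]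
    exact abs_signFun_le A B ω

theorem neg_coe_ae_eq_signFun (hz : (z : Lp ℝ ∞ μ) =ᵐ[μ] signFun A B) :
    ((-z : Metric.sphere (0 : Lp ℝ ∞ μ) 1) : Lp ℝ ∞ μ) =ᵐ[μ] signFun B A := by
  filter_upwards [hz, Lp.coeFn_neg (z : Lp ℝ ∞ μ)] with ω h1 h2
  rw [show ((-z : Metric.sphere (0 : Lp ℝ ∞ μ) 1) : Lp ℝ ∞ μ) = -z from rfl, h2, Pi.neg_apply, h1,
    signFun, signFun, neg_sub]

theorem false_of_mem_right (hf : IsValueSystem T f) (hT : IsPhaseIsometry T)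
    (hsurj : Function.Surjective T) (hB : MeasurableSet B) (hAB : Disjoint A B)
    (hz : (z : Lp ℝ ∞ μ) =ᵐ[μ] signFun A B) {U V : AEUltrafilter μ} (hU : B ∈ U.1) (hV : B ∈ V.1)
    (hTU : f U (T z) = U.value z) (hTV : f V (T z) = -V.value z) : False := by
  have hcoe : ((-z : Metric.sphere (0 : Lp ℝ ∞ μ) 1) : Lp ℝ ∞ μ) = -z := rfl
  refine hf.false_of_mem_left hT hB hAB.symm (neg_coe_ae_eq_signFun hz) hU hV ?_ ?_
  · rw [hT.apply_neg hsurj, hcoe, map_neg, hTU, AEUltrafilter.value_neg]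
  · rw [hT.apply_neg hsurj, hcoe, map_neg, hTV, AEUltrafilter.value_neg]

/-- If the sign of `T (1_A - 1_B)` were positive on `A` and negative on `B`, then the functionals
could not distinguish `T (1_A - 1_B)` from `± T (1_{A ∪ B})`, against injectivity up to sign. -/
theorem false_of_mem_left_of_mem_right (hf : IsValueSystem T f) (hT : IsPhaseIsometry T)
    (hsurj : Function.Surjective T) (hA : MeasurableSet A) (hB : MeasurableSet B)
    (hAB : Disjoint A B) (hz : (z : Lp ℝ ∞ μ) =ᵐ[μ] signFun A B) {U V : AEUltrafilter μ}
    (hU : A ∈ U.1) (hV : B ∈ V.1)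
    (hTU : f U (T z) = U.value z) (hTV : f V (T z) = -V.value z) : False := by
  obtain ⟨c, hc⟩ := AEUltrafilter.exists_sphere_signFun (U := U) (hA.union hB)
    MeasurableSet.empty (Set.disjoint_empty _)
    (by rw [Set.union_empty]; exact mem_of_superset hU Set.subset_union_left)
  have hcval : ∀ W : AEUltrafilter μ, A ∪ B ∈ W.1 → W.value c = 1 := fun W hW =>
    AEUltrafilter.value_signFun_left hc (Set.disjoint_empty _) hW
  have hor : ∀ W : AEUltrafilter μ, f W (T z) = W.value z ∨ f W (T z) = -W.value z := fun W =>
    abs_eq_abs.1 (hf.abs_apply W z)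
  have hTz : ∀ W : AEUltrafilter μ, f W (T z) = W.value c := by
    intro W
    by_cases hAW : A ∈ W.1
    · rw [hcval W (mem_of_superset hAW Set.subset_union_left)]
      rcases hor W with h | h
      · rw [h, AEUltrafilter.value_signFun_left hz hAB hAW]
      · exact (hf.false_of_mem_left hT hA hAB hz hU hAW hTU h).elim
    by_cases hBW : B ∈ W.1
    · rw [hcval W (mem_of_superset hBW Set.subset_union_right)]
      rcases hor W with h | h
      · exact (hf.false_of_mem_right hT hsurj hB hAB hz hBW hV h hTV).elim
      · rw [h, AEUltrafilter.value_signFun_right hz hAB hBW, neg_neg]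
    · have hz0 := AEUltrafilter.value_signFun_of_notMem hz hAW hBW
      have hc0 : W.value c = 0 := AEUltrafilter.value_signFun_of_notMem hc
        (fun h => (Ultrafilter.union_mem_iff.1 h).elim hAW hBW) W.1.empty_notMem
      rcases hor W with h | h <;> rw [h, hz0, hc0]
      exact neg_zero
  obtain ⟨σ, hσ, hcσ⟩ := hf.hasCoherentSign_indicator hT hc
  have hzero : (T z : Y) - σ • (T c : Y) = 0 := by
    refine hf.eq_zero_of_forall_apply hsurj fun W => ?_
    rw [map_sub, map_smul, smul_eq_mul, hTz, hcσ, ← mul_assoc]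
    rcases hσ with rfl | rfl <;> ring
  have hcoe : ((-c : Metric.sphere (0 : Lp ℝ ∞ μ) 1) : Lp ℝ ∞ μ) = -c := rfl
  have hzU := AEUltrafilter.value_signFun_left hz hAB hU
  have hzV := AEUltrafilter.value_signFun_right hz hAB hV
  have hcU := hcval U (mem_of_superset hU Set.subset_union_left)
  have hcV := hcval V (mem_of_superset hV Set.subset_union_right)
  have hzc : z = c ∨ z = -c := by
    refine hT.eq_or_eq_neg ?_
    rw [sub_eq_zero] at hzero
    rcases hσ with rfl | rfl
    · left; rw [hzero, one_smul]
    · right; rw [hzero, neg_one_smul]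
  rcases hzc with rfl | rfl
  · linarith
  · rw [hcoe, AEUltrafilter.value_neg] at hzU
    linarith

theorem hasCoherentSign_signFun (hf : IsValueSystem T f) (hT : IsPhaseIsometry T)
    (hsurj : Function.Surjective T) (hA : MeasurableSet A) (hB : MeasurableSet B)
    (hAB : Disjoint A B) (hz : (z : Lp ℝ ∞ μ) =ᵐ[μ] signFun A B) : HasCoherentSign T f z := by
  refine hf.hasCoherentSign_of_forall fun U V hU hV hTU hTV => ?_
  have hmem : ∀ W : AEUltrafilter μ, W.value z ≠ 0 → A ∈ W.1 ∨ B ∈ W.1 := by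
    intro W hW
    by_contra! h
    exact hW (AEUltrafilter.value_signFun_of_notMem hz h.1 h.2)
  rcases hmem U hU with hU | hU <;> rcases hmem V hV with hV | hV
  · exact hf.false_of_mem_left hT hA hAB hz hU hV hTU hTV
  · exact hf.false_of_mem_left_of_mem_right hT hsurj hA hB hAB hz hU hV hTU hTV
  · have hcoe : ((-z : Metric.sphere (0 : Lp ℝ ∞ μ) 1) : Lp ℝ ∞ μ) = -z := rfl
    refine hf.false_of_mem_left_of_mem_right hT hsurj hB hA hAB.symm (neg_coe_ae_eq_signFun hz)
      hU hV ?_ ?_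
    · rw [hT.apply_neg hsurj, hcoe, map_neg, hTU, AEUltrafilter.value_neg]
    · rw [hT.apply_neg hsurj, hcoe, map_neg, hTV, AEUltrafilter.value_neg]
  · exact hf.false_of_mem_right hT hsurj hB hAB hz hU hV hTU hTV

end TwoSets

theorem hasCoherentSign (hf : IsValueSystem T f) (hT : IsPhaseIsometry T)
    (hsurj : Function.Surjective T) (x : Metric.sphere (0 : Lp ℝ ∞ μ) 1) :
    HasCoherentSign T f x := by
  refine hf.hasCoherentSign_of_forall fun U V hU hV hTU hTV => ?_
  -- a threshold below both `|U.value x|` and `|V.value x|`; the test vector is the sign of `x`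
  -- where `|x|` exceeds it
  obtain ⟨δ, hδ, hδU, hδV⟩ : ∃ δ > 0, δ < |U.value x| ∧ δ < |V.value x| := by
    obtain ⟨δ, hδ, h⟩ := exists_between (lt_min (abs_pos.2 hU) (abs_pos.2 hV))
    exact ⟨δ, hδ, lt_min_iff.1 h⟩
  have hxm : Measurable (x : Lp ℝ ∞ μ) := (Lp.stronglyMeasurable _).measurable
  let A : Set Ω := {ω | δ < (x : Lp ℝ ∞ μ) ω}
  let B : Set Ω := {ω | (x : Lp ℝ ∞ μ) ω < -δ}
  have hA : MeasurableSet A := measurableSet_lt measurable_const hxm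
  have hB : MeasurableSet B := measurableSet_lt hxm measurable_const
  have hAB : Disjoint A B := Set.disjoint_left.2 fun ω h h' => by
    have h1 : δ < (x : Lp ℝ ∞ μ) ω := h
    have h2 : (x : Lp ℝ ∞ μ) ω < -δ := h'
    linarith
  have hmem : ∀ W : AEUltrafilter μ, δ < |W.value x| →
      (0 < W.value x ∧ A ∈ W.1) ∨ (W.value x < 0 ∧ B ∈ W.1) := by
    intro W hW
    rcases lt_abs.1 hW with h | h
    · exact Or.inl ⟨hδ.trans h, (W.tendsto_value x).eventually_const_lt h⟩
    · exact Or.inr ⟨by linarith, (W.tendsto_value x).eventually_lt_const (lt_neg.1 h)⟩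
  obtain ⟨z, hz⟩ := AEUltrafilter.exists_sphere_signFun (U := U) hA hB hAB (by
    rcases hmem U hδU with h | h
    · exact mem_of_superset h.2 Set.subset_union_left
    · exact mem_of_superset h.2 Set.subset_union_right)
  have hval : ∀ W : AEUltrafilter μ, δ < |W.value x| →
      |W.value z| = 1 ∧ 0 < W.value x * W.value z := by
    intro W hW
    rcases hmem W hW with ⟨h1, h2⟩ | ⟨h1, h2⟩
    · rw [AEUltrafilter.value_signFun_left hz hAB h2]
      exact ⟨abs_one, by linarith⟩
    · rw [AEUltrafilter.value_signFun_right hz hAB h2]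
      exact ⟨by simp, by linarith⟩
  refine hf.false_of_test hT ?_ (hf.hasCoherentSign_signFun hT hsurj hA hB hAB hz)
    (hval U hδU).1 (hval V hδV).1 (hval U hδU).2 (hval V hδV).2 hTU hTV
  refine Linfty.norm_sub_le_of_ae zero_le_one ?_
  filter_upwards [hz, Linfty.ae_abs_le_one x] with ω h1 h2
  have h3 := abs_le.1 h2
  rw [h1]
  by_cases hωA : ω ∈ A
  · have : δ < (x : Lp ℝ ∞ μ) ω := hωA
    rw [signFun_of_mem_left hAB hωA, abs_le]
    constructor <;> linarith
  by_cases hωB : ω ∈ B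
  · have : (x : Lp ℝ ∞ μ) ω < -δ := hωB
    rw [signFun_of_mem_right hAB hωB, abs_le]
    constructor <;> linarith
  · rwa [signFun_of_notMem hωA hωB, sub_zero]

end IsValueSystem

end Sign

/-! ### The linear extension -/

section Extension

variable {Ω : Type*} [MeasurableSpace Ω] {μ : Measure Ω}
  {Y : Type*} [NormedAddCommGroup Y] [NormedSpace ℝ Y]
  {T : Metric.sphere (0 : Lp ℝ ∞ μ) 1 → Metric.sphere (0 : Y) 1}
  {f : AEUltrafilter μ → StrongDual ℝ Y}

theorem IsValueSystem.eq_of_forall_apply (hf : IsValueSystem T f) (hsurj : Function.Surjective T)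
    {y z : Y} (h : ∀ U, f U y = f U z) : y = z :=
  sub_eq_zero.1 (hf.eq_zero_of_forall_apply hsurj fun U => by rw [map_sub, h, sub_self])

/-- The homogeneous extension of `x ↦ ± T x`, with the sign provided by
`IsValueSystem.hasCoherentSign`. -/
theorem IsValueSystem.exists_apply_eq_value (hf : IsValueSystem T f) (hT : IsPhaseIsometry T)
    (hsurj : Function.Surjective T) (x : Lp ℝ ∞ μ) :
    ∃ y : Y, ‖y‖ = ‖x‖ ∧ ∀ U, f U y = U.value x := by
  rcases eq_or_ne x 0 with rfl | hx
  · refine ⟨0, by simp, fun U => ?_⟩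
    rw [map_zero, ← zero_smul ℝ (0 : Lp ℝ ∞ μ), AEUltrafilter.value_smul, zero_mul]
  have hn : ‖x‖ ≠ 0 := norm_ne_zero_iff.2 hx
  let w : Metric.sphere (0 : Lp ℝ ∞ μ) 1 := ⟨‖x‖⁻¹ • x, by simp [norm_smul, hn]⟩
  obtain ⟨σ, hσ, hw⟩ := hf.hasCoherentSign hT hsurj w
  refine ⟨‖x‖ • σ • (T w : Y), ?_, fun U => ?_⟩
  · have : ‖σ‖ = 1 := by rcases hσ with rfl | rfl <;> simp
    rw [norm_smul, norm_smul, norm_coe_sphere, norm_norm, this, mul_one, mul_one]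
  · have hwx : U.value w = ‖x‖⁻¹ * U.value x := AEUltrafilter.value_smul _ _
    rw [map_smul, map_smul, smul_eq_mul, smul_eq_mul, hw, hwx]
    rcases hσ with rfl | rfl <;> field_simp

/-- The linear isometry `L^∞(μ) → Y` determined by `f U (Φ x) = U.value x` for every `U`. -/
theorem IsValueSystem.exists_linearIsometry (hf : IsValueSystem T f) (hT : IsPhaseIsometry T)
    (hsurj : Function.Surjective T) :
    ∃ Φ : Lp ℝ ∞ μ →ₗᵢ[ℝ] Y, ∀ x U, f U (Φ x) = U.value x := by
  choose F hF hFU using hf.exists_apply_eq_value hT hsurj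
  exact ⟨{ toFun := F
           map_add' := fun x y => hf.eq_of_forall_apply hsurj fun U => by
             rw [map_add, hFU, hFU, hFU, AEUltrafilter.value_add]
           map_smul' := fun c x => hf.eq_of_forall_apply hsurj fun U => by
             rw [RingHom.id_apply, map_smul, hFU, hFU, AEUltrafilter.value_smul, smul_eq_mul]
           norm_map' := hF }, hFU⟩

end Extension

theorem mainTheorem5 {Ω : Type*} [MeasurableSpace Ω] (μ : Measure Ω)
    {Y : Type*} [NormedAddCommGroup Y] [NormedSpace ℝ Y] [CompleteSpace Y]
    (T : Metric.sphere (0 : Lp ℝ ∞ μ) 1 → Metric.sphere (0 : Y) 1)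
    (hT : IsPhaseIsometry T) (hsurj : Function.Surjective T) :
    ∃ S : Metric.sphere (0 : Lp ℝ ∞ μ) 1 → Metric.sphere (0 : Y) 1,
      PhaseEquivalent S T ∧ Isometry S ∧
        ∃ U : Lp ℝ ∞ μ →ₗᵢ[ℝ] Y, Function.Surjective U ∧
          ∀ f : Metric.sphere (0 : Lp ℝ ∞ μ) 1, U (f : Lp ℝ ∞ μ) = (S f : Y) := by
  obtain ⟨f, hf⟩ := exists_isValueSystem hT hsurj
  obtain ⟨Φ, hΦ⟩ := hf.exists_linearIsometry hT hsurj
  choose σ hσ hTσ using hf.hasCoherentSign hT hsurj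
  have hsq : ∀ x, σ x * σ x = 1 := fun x => by rcases hσ x with h | h <;> rw [h] <;> norm_num
  have hΦT : ∀ x : Metric.sphere (0 : Lp ℝ ∞ μ) 1, Φ x = σ x • (T x : Y) := fun x =>
    hf.eq_of_forall_apply hsurj fun U => by
      rw [hΦ, map_smul, smul_eq_mul, hTσ, ← mul_assoc, hsq, one_mul]
  refine ⟨fun x => ⟨Φ x, ?_⟩, ⟨fun x => ⟨σ x, ?_⟩, fun x => (hΦT x).symm⟩, ?_, Φ, ?_, fun _ => rfl⟩
  · rw [mem_sphere_zero_iff_norm, Φ.norm_map, norm_coe_sphere]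
  · exact (hσ x).symm
  · exact Isometry.of_dist_eq fun x y => Φ.dist_map x y
  · intro y
    rcases eq_or_ne y 0 with rfl | hy
    · exact ⟨0, map_zero Φ⟩
    obtain ⟨w, hw⟩ := exists_eq_norm_smul_of_surjective hsurj hy
    refine ⟨‖y‖ • σ w • (w : Lp ℝ ∞ μ), ?_⟩
    rw [map_smul, map_smul, hΦT, smul_smul (σ w), hsq, one_smul, ← hw]
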